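/- Let $C=\{F=0\}\subset\mathbb{P}^2$ be a plane curve of degree $3$ over $\mathbb{F}_4$ (so $F\in\mathbb{F}_4[X_0,X_1,X_2]$ is a nonzero form of degree $3$) without $\mathbb{F}_4$-linear components, i.e. no nonzero linear form over $\mathbb{F}_4$ divides $F$. Suppose that the set $C(\mathbb{F}_4)$ of $\mathbb{F}_4$-points of $C$ has exactly $9$ elements. Then $C$ is absolutely irreducible (i.e. $F$ is irreducible over the algebraic closure of $\mathbb{F}_4$), and all $\mathbb{F}_4$-points of $C$ are nonsingular points of $C$. Suppose in addition that every $\mathbb{F}_4$-point of $C$ is a flex, i.e. $i(T_P(C).C;P)=3$ for every $P\in C(\mathbb{F}_4)$, where $T_P(C)$ is the embedded tangent line to $C$ at $P$ and $i(D.E;P)$ is the local intersection multiplicity of $D$ and $E$ at $P$. Then $C$ is a Hermitian curve, i.e. there are $\rho\in\mathbb{F}_4^{*}$ and a $3\times 3$ matrix $A$ over $\mathbb{F}_4$ with ${}^t\!A=A^{(2)}$ (where $A^{(2)}$ is obtained from $A$ by squaring every entry) such that $$\rho F=(X_0^2,X_1^2,X_2^2)\,A\;{}^t(X_0,X_1,X_2);$$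 moreover $C$ is projectively equivalent over $\mathbb{F}_4$ to the curve $X_0^3+X_1^3+X_2^3=0$. -/

import Mathlib

open MvPolynomial
open scoped LinearAlgebra.Projectivization

noncomputable section

namespace PlaneCurve

variable {K : Type*} [Field K]

/-- The plane curve `{F = 0}` of degree `d` over `K` is given by a nonzero form `F` of degree `d`
in the homogeneous coordinates `X 0, X 1, X 2` (which is unique up to a nonzero constant). -/
def IsPlaneCurve (F : MvPolynomial (Fin 3) K) (d : ℕ) : Prop :=
  F ≠ 0 ∧ F.IsHomogeneous d

/-- The curve `{F = 0}` has a `K`-linear component, i.e. a component that is a line over `K`. -/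
def HasLinearComponent (F : MvPolynomial (Fin 3) K) : Prop :=
  ∃ L : MvPolynomial (Fin 3) K, IsPlaneCurve L 1 ∧ L ∣ F

/-- Irreducibility over the algebraic closure of the ground field. -/
def IsAbsolutelyIrreducible (F : MvPolynomial (Fin 3) K) : Prop :=
  Irreducible (MvPolynomial.map (algebraMap K (AlgebraicClosure K)) F)

/-- The set of `K`-points of the curve `{F = 0}` in the projective plane over `K`. -/
def points (F : MvPolynomial (Fin 3) K) : Set (ℙ K (Fin 3 → K)) :=
  {P | eval P.rep F = 0}

/-- For a form, the condition does not depend on the choice of homogeneous coordinates. -/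
theorem mk_mem_points {F : MvPolynomial (Fin 3) K} {d : ℕ} (hF : F.IsHomogeneous d)
    {v : Fin 3 → K} (hv : v ≠ 0) :
    Projectivization.mk K v hv ∈ points F ↔ eval v F = 0 := by
  obtain ⟨a, ha⟩ := Projectivization.exists_smul_eq_mk_rep K v hv
  have h : eval (Projectivization.mk K v hv).rep F = (a : K) ^ d * eval v F := by
    rw [← ha, eval_eq, eval_eq, Finset.mul_sum]
    refine Finset.sum_congr rfl fun m hm => ?_
    have hd : ∑ i ∈ m.support, m i = d := by
      have := hF (mem_support_iff.mp hm)
      simpa [Finsupp.weight_apply, Finsupp.sum] using this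
    simp only [Units.smul_def, Pi.smul_apply, smul_eq_mul, mul_pow, Finset.prod_mul_distrib,
      Finset.prod_pow_eq_pow_sum, hd]
    ring
  simp [points, h]

/-- The point `P` is a nonsingular point of the curve `{F = 0}` (meant for points on the curve). -/
def IsNonsingularAt (F : MvPolynomial (Fin 3) K) (P : ℙ K (Fin 3 → K)) : Prop :=
  ∃ i, eval P.rep (pderiv i F) ≠ 0

/-- The form `∑ i, (∂F/∂X_i)(P) X_i`, which defines the embedded tangent line to `{F = 0}` at a
nonsingular point `P`. (It is zero if `P` is singular.) -/
def tangentLine (F : MvPolynomial (Fin 3) K) (P : ℙ K (Fin 3 → K)) : MvPolynomial (Fin 3) K :=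
  ∑ i, C (eval P.rep (pderiv i F)) * X i

/-- The homogeneous prime ideal of the point with homogeneous coordinates `v`, as the kernel of
restriction to the line through `0` and `v` in affine 3-space, `X_i ↦ v_i T`. -/
def vectorIdeal (v : Fin 3 → K) : Ideal (MvPolynomial (Fin 3) K) :=
  RingHom.ker (aeval (R := K) fun i => Polynomial.C (v i) * Polynomial.X :
    MvPolynomial (Fin 3) K →ₐ[K] Polynomial K)

/-- The homogeneous prime ideal of a `K`-point of the projective plane. -/
def pointIdeal (P : ℙ K (Fin 3 → K)) : Ideal (MvPolynomial (Fin 3) K) :=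
  vectorIdeal P.rep

instance pointIdeal_isPrime (P : ℙ K (Fin 3 → K)) : (pointIdeal P).IsPrime :=
  RingHom.ker_isPrime _

/-- The ideal of a point does not depend on the choice of homogeneous coordinates. -/
theorem pointIdeal_mk {v : Fin 3 → K} (hv : v ≠ 0) :
    pointIdeal (Projectivization.mk K v hv) = vectorIdeal v := by
  obtain ⟨a, ha⟩ := Projectivization.exists_smul_eq_mk_rep K v hv
  have key : ∀ (b : K) (w : Fin 3 → K), vectorIdeal w ≤ vectorIdeal (b • w) := by
    intro b w G hG
    have h : (aeval (R := K) fun i => Polynomial.C ((b • w) i) * Polynomial.X :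
        MvPolynomial (Fin 3) K →ₐ[K] Polynomial K) =
        (Polynomial.aeval (Polynomial.C b * Polynomial.X)).comp
          (aeval (R := K) fun i => Polynomial.C (w i) * Polynomial.X) := by
      ext i : 1
      simp [Polynomial.aeval_C, mul_assoc, mul_left_comm]
    simp only [vectorIdeal, RingHom.mem_ker] at hG ⊢
    rw [h, AlgHom.comp_apply, hG, map_zero]
  apply le_antisymm
  · have := key ((a⁻¹ : Kˣ) : K) (Projectivization.mk K v hv).rep
    rwa [← ha, Units.smul_def, smul_smul, Units.inv_mul, one_smul, ← Units.smul_def, ha] at this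
  · rw [pointIdeal, ← ha]
    exact key a v

/-- The local intersection multiplicity `i(D.E; P)` of the curves `{D = 0}` and `{E = 0}` at a
`K`-point `P`: the length of the module `(S / (D, E))_𝔭` over `S_𝔭`, where `S = K[X_0, X_1, X_2]`
and `𝔭` is the homogeneous prime ideal of `P`. It is infinite on a common component. -/
def intersectionMultiplicity (D E : MvPolynomial (Fin 3) K) (P : ℙ K (Fin 3 → K)) : ℕ∞ :=
  Module.length (Localization.AtPrime (pointIdeal P))
    (Localization.AtPrime (pointIdeal P) ⧸
      (Ideal.span {D, E}).map
        (algebraMap (MvPolynomial (Fin 3) K) (Localization.AtPrime (pointIdeal P))))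

/-- Hermitian polynomials over a field with `q = r ^ 2` elements:
`(X_0^r, X_1^r, X_2^r) A (X_0, X_1, X_2)ᵗ` with `Aᵗ = A^(r)` (entrywise `r`-th power). -/
def IsHermitianPolynomial (r : ℕ) (F : MvPolynomial (Fin 3) K) : Prop :=
  ∃ A : Matrix (Fin 3) (Fin 3) K, A.transpose = A.map (fun a => a ^ r) ∧
    F = ∑ i, ∑ j, X i ^ r * C (A i j) * X j

/-- The curve `{F = 0}` over a field with `r ^ 2` elements is Hermitian: some nonzero constant
multiple of `F` is a Hermitian polynomial. -/
def IsHermitianCurve (r : ℕ) (F : MvPolynomial (Fin 3) K) : Prop :=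
  ∃ ρ : K, ρ ≠ 0 ∧ IsHermitianPolynomial r (C ρ * F)

/-- The curves `{F = 0}` and `{G = 0}` are projectively equivalent over `K`: an invertible
`K`-linear change of coordinates turns `F` into a nonzero constant multiple of `G`. -/
def ProjectivelyEquivalent (F G : MvPolynomial (Fin 3) K) : Prop :=
  ∃ (M : GL (Fin 3) K) (c : K), c ≠ 0 ∧
    bind₁ (fun i => ∑ j, C ((M : Matrix (Fin 3) (Fin 3) K) i j) * X j) F = C c * G

end PlaneCurve

end

/-! Everything reduces to counting zeros of `F` in affine 3-space: nine projective points give 9·3 +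
1 = 28 vectors (`ncard_zeros`). Because 3 ≤ 4, a cubic form over this field is determined by its
values, so `F` cannot vanish on a rational plane through 0 (`exists_eval_ne_zero`).

Nonsingularity: along a direction `v` where `F` is singular, `F` is affine linear, which allows at
most 4 + 15 = 19 zeros (`exists_polar_ne_zero`).

Irreducibility: a linear factor over an extension has a Frobenius conjugate that also divides and is
not proportional to it, so `F` is a product of three linear forms. Each of them vanishes on at most
4 rational vectors, and 12 < 28 (`not_linearForm_dvd_map`).

Hermitian form: if the tangent at a smooth point is not a flex tangent, the local intersection
number is at most 2 (`intersectionMultiplicity_le_two`). At a flex the cubic has a Weierstrass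
equation with at most 28 zeros. Equality makes every quadratic fibre split, and this fixes the
coefficients (`weierstrass_coeffs`). The resulting form `y³ + x²z + xz²` becomes the Fermat cubic by
means of a cube root of unity, and the Hermitian matrix is read off from there. -/

namespace PlaneCurve

/-! ### Linear forms, cubic forms and their polars. -/

/-- The linear form with coefficient vector `l`. -/
noncomputable def linearForm {R : Type*} [CommSemiring R] (l : Fin 3 → R) :
    MvPolynomial (Fin 3) R :=
  ∑ i, C (l i) * X i

@[simp] theorem eval_linearForm {R : Type*} [CommSemiring R] (l x : Fin 3 → R) :
    eval x (linearForm l) = l 0 * x 0 + l 1 * x 1 + l 2 * x 2 := by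
  simp [linearForm, Fin.sum_univ_three]

theorem isHomogeneous_linearForm {R : Type*} [CommSemiring R] (l : Fin 3 → R) :
    (linearForm l).IsHomogeneous 1 :=
  IsHomogeneous.sum _ _ _ fun i _ => isHomogeneous_C_mul_X (l i) i

theorem coeff_linearForm {R : Type*} [CommSemiring R] (l : Fin 3 → R) (i : Fin 3) :
    coeff (Finsupp.single i 1) (linearForm l) = l i := by
  simp [linearForm, coeff_sum, coeff_C_mul, coeff_X, Finsupp.single_left_inj]

theorem linearForm_ne_zero {R : Type*} [CommSemiring R] {l : Fin 3 → R} (hl : l ≠ 0) :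
    linearForm l ≠ 0 := by
  intro h
  apply hl
  ext i
  rw [← coeff_linearForm l i, h, coeff_zero, Pi.zero_apply]

theorem exists_eq_linearForm {R : Type*} [CommSemiring R] {L : MvPolynomial (Fin 3) R}
    (hL : L.IsHomogeneous 1) : ∃ l, L = linearForm l := by
  have h : L ∈ homogeneousSubmodule (Fin 3) R 1 := hL
  rw [homogeneousSubmodule_one_eq_span_X] at h
  obtain ⟨c, hc⟩ := (Submodule.mem_span_range_iff_exists_fun R).1 h
  exact ⟨c, by simp [← hc, linearForm, smul_eq_C_mul]⟩

theorem map_linearForm {R S : Type*} [CommSemiring R] [CommSemiring S] (f : R →+* S)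
    (l : Fin 3 → R) : map f (linearForm l) = linearForm (f ∘ l) := by
  simp [linearForm]

/-- A ternary cubic form is determined by its ten coefficients. -/
theorem exists_cubic_coeffs {R : Type*} [CommRing R] {F : MvPolynomial (Fin 3) R}
    (hF : F.IsHomogeneous 3) : ∃ a : Fin 10 → R,
      F = C (a 0) * X 0 ^ 3 + C (a 1) * X 1 ^ 3 + C (a 2) * X 2 ^ 3 +
        C (a 3) * X 0 ^ 2 * X 1 + C (a 4) * X 0 ^ 2 * X 2 + C (a 5) * X 1 ^ 2 * X 0 +
        C (a 6) * X 1 ^ 2 * X 2 + C (a 7) * X 2 ^ 2 * X 0 + C (a 8) * X 2 ^ 2 * X 1 +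
        C (a 9) * X 0 * X 1 * X 2 := by
  rw [F.as_sum]
  apply Finset.sum_induction (p := fun F : MvPolynomial (Fin 3) R => ∃ a : Fin 10 → R,
      F = C (a 0) * X 0 ^ 3 + C (a 1) * X 1 ^ 3 + C (a 2) * X 2 ^ 3 +
        C (a 3) * X 0 ^ 2 * X 1 + C (a 4) * X 0 ^ 2 * X 2 + C (a 5) * X 1 ^ 2 * X 0 +
        C (a 6) * X 1 ^ 2 * X 2 + C (a 7) * X 2 ^ 2 * X 0 + C (a 8) * X 2 ^ 2 * X 1 +
        C (a 9) * X 0 * X 1 * X 2)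
  · rintro _ _ ⟨a, rfl⟩ ⟨b, rfl⟩
    refine ⟨a + b, ?_⟩
    simp only [Pi.add_apply, map_add]
    ring
  · exact ⟨0, by simp⟩
  · intro m hm
    have hd : m 0 + m 1 + m 2 = 3 := by
      have := hF.degree_eq_sum_deg_support hm
      rw [← Fin.sum_univ_three (fun i => m i), ← Finsupp.degree_eq_sum, Finsupp.degree_apply]
      exact this.symm
    have key : monomial m (coeff m F) =
        C (coeff m F) * (X 0 ^ m 0 * X 1 ^ m 1 * X 2 ^ m 2) := by
      rw [monomial_eq, Finsupp.prod_fintype _ _ (by simp), Fin.prod_univ_three]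
    rw [key]
    generalize coeff m F = c
    have h0 : m 0 ≤ 3 := by omega
    have h1 : m 1 ≤ 3 := by omega
    have h2 : m 2 = 3 - m 0 - m 1 := by omega
    rw [h2]
    generalize m 0 = i at *
    generalize m 1 = j at *
    have aux : ∃ k : Fin 10, ∀ x y z : MvPolynomial (Fin 3) R,
        x ^ i * y ^ j * z ^ (3 - i - j) =
          ![x ^ 3, y ^ 3, z ^ 3, x ^ 2 * y, x ^ 2 * z, y ^ 2 * x, y ^ 2 * z, z ^ 2 * x,
            z ^ 2 * y, x * y * z] k := by
      interval_cases i <;> interval_cases j <;> first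
        | omega
        | (refine ⟨0, fun x y z => ?_⟩; simp; done)
        | (refine ⟨1, fun x y z => ?_⟩; simp; done)
        | (refine ⟨2, fun x y z => ?_⟩; simp; done)
        | (refine ⟨3, fun x y z => ?_⟩; simp; done)
        | (refine ⟨4, fun x y z => ?_⟩; simp; done)
        | (refine ⟨5, fun x y z => ?_⟩; simp [mul_comm]; done)
        | (refine ⟨6, fun x y z => ?_⟩; simp; done)
        | (refine ⟨7, fun x y z => ?_⟩; simp [mul_comm]; done)
        | (refine ⟨8, fun x y z => ?_⟩; simp [mul_comm]; done)
        | exact ⟨9, fun x y z => by simp⟩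
    obtain ⟨k, hk⟩ := aux
    refine ⟨Pi.single k c, ?_⟩
    rw [hk]
    fin_cases k <;> simp <;> ring

/-- The polar form of a cubic: the derivative of `F` at `v` in direction `w`. -/
noncomputable def polar {R : Type*} [CommRing R] (F : MvPolynomial (Fin 3) R)
    (v w : Fin 3 → R) : R :=
  eval w (linearForm fun i => eval v (pderiv i F))

/-- Taylor expansion along a line. By the symmetry between `v` and `w` both mixed coefficients are
first derivatives, so no division by 2 occurs and the formula is usable in characteristic 2. -/
theorem eval_smul_add_smul {R : Type*} [CommRing R] {F : MvPolynomial (Fin 3) R}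
    (hF : F.IsHomogeneous 3) (v w : Fin 3 → R) (s t : R) :
    eval (s • v + t • w) F = s ^ 3 * eval v F + s ^ 2 * t * polar F v w +
      s * t ^ 2 * polar F w v + t ^ 3 * eval w F := by
  obtain ⟨a, rfl⟩ := exists_cubic_coeffs hF
  simp [polar, pderiv_X, Pi.single_apply]
  ring

theorem polar_self {R : Type*} [CommRing R] {F : MvPolynomial (Fin 3) R}
    (hF : F.IsHomogeneous 3) (v : Fin 3 → R) : polar F v v = 3 * eval v F := by
  obtain ⟨a, rfl⟩ := exists_cubic_coeffs hF
  simp [polar, pderiv_X, Pi.single_apply]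
  ring

theorem eval_smul_of_cubic {R : Type*} [CommRing R] {F : MvPolynomial (Fin 3) R}
    (hF : F.IsHomogeneous 3) (v : Fin 3 → R) (s : R) :
    eval (s • v) F = s ^ 3 * eval v F := by
  simpa using eval_smul_add_smul hF v 0 s 0

theorem polar_add {R : Type*} [CommRing R] (F : MvPolynomial (Fin 3) R)
    (v w u : Fin 3 → R) : polar F v (w + u) = polar F v w + polar F v u := by
  simp [polar]; ring

theorem polar_smul {R : Type*} [CommRing R] (F : MvPolynomial (Fin 3) R)
    (v w : Fin 3 → R) (c : R) : polar F v (c • w) = c * polar F v w := by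
  simp [polar]; ring

/-! ### Zeros of a cubic over the field with four elements. -/

section Field

variable {K : Type*} [Field K]

/-- A cubic form over a field with four elements that vanishes on the plane `l = 0` is divisible
by the linear form `l`. -/
theorem linearForm_dvd_of_forall_eval (hK : Nat.card K = 4) {F : MvPolynomial (Fin 3) K}
    (hF : F.IsHomogeneous 3) {l : Fin 3 → K} (hl : l ≠ 0)
    (h : ∀ x, eval x (linearForm l) = 0 → eval x F = 0) : linearForm l ∣ F := by
  obtain ⟨j, hj⟩ := Function.ne_iff.1 hl
  rw [Pi.zero_apply] at hj
  let u : Fin 3 → K := Pi.single j (l j)⁻¹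
  have hu : eval u (linearForm l) = 1 := by
    simp only [u, linearForm, map_sum, map_mul, eval_C, eval_X]
    rw [Finset.sum_eq_single j] <;> simp +contextual [hj]
  -- `φ` is the projection along `u` onto the plane `l = 0`. It is the identity modulo `l`, and `F ∘
  -- φ` vanishes at every point, hence is the zero form since 3 ≤ 4.
  let φ : Fin 3 → MvPolynomial (Fin 3) K := fun i => X i - linearForm l * C (u i)
  have hG : bind₁ φ F = 0 := by
    have hhom : (bind₁ φ F).IsHomogeneous 3 := by
      have := hF.aeval φ (n := 1) fun i => (isHomogeneous_X K i).sub (by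
        simpa using (isHomogeneous_linearForm l).mul (isHomogeneous_C (Fin 3) (u i)))
      simpa using this
    refine hhom.funext_of_le_card (isHomogeneous_zero _ _ _) (fun r => ?_) ?_
    · have : eval r (bind₁ φ F) = eval (r - eval r (linearForm l) • u) F := by
        rw [← coe_aeval_eq_eval, ← coe_aeval_eq_eval, RingHom.coe_coe, RingHom.coe_coe,
          aeval_bind₁]
        congr 2
        ext i
        simp [φ]
      rw [this, map_zero]
      apply h
      have e : eval (r - eval r (linearForm l) • u) (linearForm l) =
          eval r (linearForm l) - eval r (linearForm l) * eval u (linearForm l) := by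
        simp; ring
      rw [e, hu]; ring
    · have : Finite K := Nat.finite_of_card_ne_zero (by omega)
      rw [← Nat.cast_card, hK]; norm_num
  have : linearForm l ∣ F - bind₁ φ F := by
    rw [← Ideal.mem_span_singleton, ← Ideal.Quotient.eq]
    have hom : (Ideal.Quotient.mkₐ K (Ideal.span {linearForm l})) =
        (Ideal.Quotient.mkₐ K (Ideal.span {linearForm l})).comp (bind₁ φ) := by
      ext i : 1
      simp [φ, Ideal.Quotient.eq_zero_iff_mem.2 (Ideal.mem_span_singleton_self (linearForm l))]
    exact DFunLike.congr_fun hom F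
  rwa [hG, sub_zero] at this

/-- A cubic form without linear components does not vanish on a line. -/
theorem exists_eval_ne_zero (hK : Nat.card K = 4) {F : MvPolynomial (Fin 3) K}
    (hF : F.IsHomogeneous 3) (hlin : ¬ HasLinearComponent F) {l : Fin 3 → K} (hl : l ≠ 0) :
    ∃ x, eval x (linearForm l) = 0 ∧ eval x F ≠ 0 := by
  by_contra! h
  exact hlin ⟨linearForm l, ⟨linearForm_ne_zero hl, isHomogeneous_linearForm l⟩,
    linearForm_dvd_of_forall_eval hK hF hl h⟩

/-- The vectors in affine space on which the form `F` vanishes are the multiples of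
representatives of the points of the curve. -/
theorem ncard_zeros [Finite K] {F : MvPolynomial (Fin 3) K}
    (hF : F.IsHomogeneous 3) :
    {x : Fin 3 → K | eval x F = 0}.ncard = (points F).ncard * (Nat.card K - 1) + 1 := by
  let f : points F × Kˣ → {x : Fin 3 → K | eval x F = 0 ∧ x ≠ 0} := fun p =>
    ⟨p.2 • p.1.1.rep, by
      have h : eval p.1.1.rep F = 0 := p.1.2
      refine ⟨?_, ?_⟩
      · rw [Units.smul_def, eval_smul_of_cubic hF, h, mul_zero]
      · rw [Units.smul_def]
        exact smul_ne_zero p.2.ne_zero p.1.1.rep_nonzero⟩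
  have hf : Function.Bijective f := by
    constructor
    · rintro ⟨⟨P, hP⟩, a⟩ ⟨⟨Q, hQ⟩, b⟩ h
      have h' : a • P.rep = b • Q.rep := congrArg Subtype.val h
      have hPQ : P = Q := by
        rw [← P.mk_rep, ← Q.mk_rep, Projectivization.mk_eq_mk_iff]
        exact ⟨a⁻¹ * b, by rw [mul_smul, ← h', inv_smul_smul]⟩
      subst hPQ
      have : a = b := by
        ext
        exact smul_left_injective K P.rep_nonzero h'
      rw [this]
    · rintro ⟨x, hx, hx0⟩
      obtain ⟨a, ha⟩ := Projectivization.exists_smul_eq_mk_rep K x hx0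
      refine ⟨⟨⟨Projectivization.mk K x hx0, (mk_mem_points hF hx0).2 hx⟩, a⁻¹⟩, ?_⟩
      apply Subtype.ext
      change a⁻¹ • (Projectivization.mk K x hx0).rep = x
      rw [← ha, inv_smul_smul]
  have hcard := Nat.card_congr (Equiv.ofBijective f hf)
  rw [Nat.card_prod, Nat.card_units, Nat.card_coe_set_eq, Nat.card_coe_set_eq] at hcard
  rw [hcard, ← Set.ncard_insert_of_notMem (a := 0) (by simp)]
  congr 1
  ext x
  have h0 : eval 0 F = 0 := by simpa using eval_smul_of_cubic hF 0 0
  by_cases hx : x = 0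
  · subst hx
    simp [h0, -eval_zero]
  · simp [hx]

end Field

/-! ### Adapted bases and counting along parallel lines. -/

/-- Nine of the ten coefficients in a new basis are values and polars of `F`; only the coefficient
of `xyz` needs a new name. -/
theorem eval_triple {R : Type*} [CommRing R] {F : MvPolynomial (Fin 3) R}
    (hF : F.IsHomogeneous 3) (v w u : Fin 3 → R) : ∃ e : R, ∀ x y z : R,
    eval (x • v + (y • w + z • u)) F = x ^ 3 * eval v F + y ^ 3 * eval w F + z ^ 3 * eval u F +
      x ^ 2 * y * polar F v w + x ^ 2 * z * polar F v u + y ^ 2 * x * polar F w v +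
      y ^ 2 * z * polar F w u + z ^ 2 * x * polar F u v + z ^ 2 * y * polar F u w +
      x * y * z * e := by
  have h : ∃ e : R, ∀ y z : R, polar F (y • w + z • u) v =
      y ^ 2 * polar F w v + z ^ 2 * polar F u v + y * z * e := by
    refine ⟨polar F (w + u) v - polar F w v - polar F u v, fun y z => ?_⟩
    obtain ⟨a, rfl⟩ := exists_cubic_coeffs hF
    simp [polar, pderiv_X, Pi.single_apply]
    ring
  obtain ⟨e, he⟩ := h
  refine ⟨e, fun x y z => ?_⟩
  have := eval_smul_add_smul hF v (y • w + z • u) x 1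
  rw [one_smul] at this
  rw [this, he, eval_smul_add_smul hF w u, polar_add, polar_smul, polar_smul]
  ring

section Field

variable {K : Type*} [Field K]

theorem linearIndependent_triple_iff {V : Type*} [AddCommGroup V] [Module K V] {v w u : V} :
    LinearIndependent K ![v, w, u] ↔
      ∀ a b c : K, a • v + (b • w + c • u) = 0 → a = 0 ∧ b = 0 ∧ c = 0 := by
  rw [Fintype.linearIndependent_iff]
  constructor
  · intro h a b c habc
    have := h ![a, b, c] (by simpa [Fin.sum_univ_three, add_assoc] using habc)
    exact ⟨this 0, this 1, this 2⟩
  · intro h g hg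
    obtain ⟨h0, h1, h2⟩ := h (g 0) (g 1) (g 2) (by
      simpa [Fin.sum_univ_three, add_assoc] using hg)
    intro i
    fin_cases i <;> assumption

/-- The coordinates with respect to a basis of `K ^ 3` are given by linear forms. -/
theorem exists_dual_basis {v w u : Fin 3 → K} (h : LinearIndependent K ![v, w, u]) :
    ∃ n : Fin 3 → Fin 3 → K, ∀ x, x = eval x (linearForm (n 0)) • v +
      (eval x (linearForm (n 1)) • w + eval x (linearForm (n 2)) • u) := by
  let b := basisOfLinearIndependentOfCardEqFinrank h (by simp)
  refine ⟨fun i j => b.repr (Pi.single j 1) i, fun x => ?_⟩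
  have key : ∀ i, eval x (linearForm fun j => b.repr (Pi.single j 1) i) = b.repr x i := by
    intro i
    have hx : x = ∑ j, x j • (Pi.single j 1 : Fin 3 → K) := by
      ext k; simp [Finset.sum_apply, Pi.single_apply]
    conv_rhs => rw [hx]
    simp [Fin.sum_univ_three, mul_comm]
  rw [key, key, key]
  have := b.sum_repr x
  rw [Fin.sum_univ_three] at this
  simpa [b, add_assoc] using this.symm

theorem exists_linearIndependent_triple {v w : Fin 3 → K} (h : LinearIndependent K ![v, w]) :
    ∃ u, LinearIndependent K ![v, w, u] := by
  obtain ⟨u, hu⟩ := exists_linearIndependent_snoc_of_lt_finrank (R := K) h (by simp)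
  have e : (Fin.snoc ![v, w] u : Fin 3 → Fin 3 → K) = ![v, w, u] := by
    ext i : 1
    fin_cases i <;> rfl
  exact ⟨u, e ▸ hu⟩

theorem exists_linearIndependent_pair {v : Fin 3 → K} (h : v ≠ 0) :
    ∃ w, LinearIndependent K ![v, w] := by
  have h1 : LinearIndependent K ![v] := LinearIndependent.of_subsingleton 0 h
  obtain ⟨u, hu⟩ := exists_linearIndependent_snoc_of_lt_finrank (R := K) h1 (by simp)
  have e : (Fin.snoc ![v] u : Fin 2 → Fin 3 → K) = ![v, u] := by
    ext i : 1
    fin_cases i <;> rfl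
  exact ⟨u, e ▸ hu⟩

theorem dual_basis_apply {v w u : Fin 3 → K} (h : LinearIndependent K ![v, w, u])
    {n : Fin 3 → Fin 3 → K} (hn : ∀ x, x = eval x (linearForm (n 0)) • v +
      (eval x (linearForm (n 1)) • w + eval x (linearForm (n 2)) • u)) (a b c : K) :
    eval (a • v + (b • w + c • u)) (linearForm (n 0)) = a ∧
    eval (a • v + (b • w + c • u)) (linearForm (n 1)) = b ∧
    eval (a • v + (b • w + c • u)) (linearForm (n 2)) = c := by
  have h1 := hn (a • v + (b • w + c • u))
  generalize eval (a • v + (b • w + c • u)) (linearForm (n 0)) = a' at *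
  generalize eval (a • v + (b • w + c • u)) (linearForm (n 1)) = b' at *
  generalize eval (a • v + (b • w + c • u)) (linearForm (n 2)) = c' at *
  have h2 := linearIndependent_triple_iff.1 h (a' - a) (b' - b) (c' - c) (by
    rw [← sub_eq_zero] at h1
    rw [← neg_eq_zero, ← h1]
    module)
  simpa [sub_eq_zero] using h2

theorem exists_eval_smul_add_smul_ne_zero (hK : Nat.card K = 4) {F : MvPolynomial (Fin 3) K}
    (hF : F.IsHomogeneous 3) (hlin : ¬ HasLinearComponent F) {v w : Fin 3 → K}
    (h : LinearIndependent K ![v, w]) : ∃ s t : K, eval (s • v + t • w) F ≠ 0 := by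
  obtain ⟨u, hu⟩ := exists_linearIndependent_triple h
  obtain ⟨n, hn⟩ := exists_dual_basis hu
  have hn2 : n 2 ≠ 0 := by
    intro h0
    have := (dual_basis_apply hu hn 0 0 1).2.2
    rw [h0] at this
    simp at this
  obtain ⟨x, hx, hxF⟩ := exists_eval_ne_zero hK hF hlin hn2
  refine ⟨eval x (linearForm (n 0)), eval x (linearForm (n 1)), ?_⟩
  have h1 := hn x
  rw [hx, zero_smul, add_zero] at h1
  rwa [← h1]

/-- Zeros are counted along the lines parallel to `v`, where `F` is a polynomial in one variable. -/
theorem sum_card_fibers [Fintype K] [DecidableEq K] (F : MvPolynomial (Fin 3) K)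
    {v w u : Fin 3 → K} (h : LinearIndependent K ![v, w, u]) :
    ∑ p : K × K, (Finset.univ.filter fun x : K =>
      eval (x • v + (p.1 • w + p.2 • u)) F = 0).card =
      {x : Fin 3 → K | eval x F = 0}.ncard := by
  obtain ⟨n, hn⟩ := exists_dual_basis h
  rw [← Finset.card_sigma, ← Set.ncard_coe_finset]
  refine Set.ncard_congr (fun q _ => q.2 • v + (q.1.1 • w + q.1.2 • u)) ?_ ?_ ?_
  · intro q hq
    simpa using hq
  · rintro ⟨⟨y, z⟩, x⟩ ⟨⟨y', z'⟩, x'⟩ _ _ he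
    obtain ⟨h0, h1, h2⟩ := dual_basis_apply h hn x y z
    obtain ⟨h0', h1', h2'⟩ := dual_basis_apply h hn x' y' z'
    dsimp only at he
    rw [he] at h0 h1 h2
    rw [← h0, ← h1, ← h2, h0', h1', h2']
  · intro x hx
    refine ⟨⟨⟨_, _⟩, _⟩, ?_, (hn x).symm⟩
    simp only [Finset.coe_sigma, Set.mem_sigma_iff, Finset.coe_univ, Set.mem_univ, true_and,
      Finset.coe_filter, Finset.mem_univ, Set.mem_ofPred_eq]
    rw [← hn x]
    exact hx

theorem linearIndependent_pair_of_triple {v w u : Fin 3 → K}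
    (h : LinearIndependent K ![v, w, u]) {y z : K} (hyz : (y, z) ≠ 0) :
    LinearIndependent K ![v, y • w + z • u] := by
  rw [LinearIndependent.pair_iff]
  intro s t hst
  obtain ⟨h0, h1, h2⟩ := linearIndependent_triple_iff.1 h s (t * y) (t * z) (by
    rw [← hst]; module)
  refine ⟨h0, ?_⟩
  by_contra ht
  exact hyz (by simp_all)

/-- A plane cubic over the field with four elements without linear components and with a
rational singular point has at most six rational points. -/
theorem exists_polar_ne_zero (hK : Nat.card K = 4) {F : MvPolynomial (Fin 3) K}
    (hF : F.IsHomogeneous 3) (hlin : ¬ HasLinearComponent F)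
    (hN : {x : Fin 3 → K | eval x F = 0}.ncard = 28) {v : Fin 3 → K} (hv : v ≠ 0)
    (hFv : eval v F = 0) : ∃ w, polar F v w ≠ 0 := by
  classical
  have : Finite K := Nat.finite_of_card_ne_zero (by omega)
  have : Fintype K := Fintype.ofFinite K
  rw [Nat.card_eq_fintype_card] at hK
  by_contra! hsing
  obtain ⟨w, hw⟩ := exists_linearIndependent_pair hv
  obtain ⟨u, hu⟩ := exists_linearIndependent_triple hw
  have hsum := sum_card_fibers F hu
  have hle : ∀ p ∈ (Finset.univ : Finset (K × K)), (Finset.univ.filter fun x : K =>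
      eval (x • v + (p.1 • w + p.2 • u)) F = 0).card ≤ if p = 0 then 4 else 1 := by
    rintro ⟨y, z⟩ -
    split_ifs with h0
    · exact (Finset.card_le_univ _).trans hK.le
    · rw [Finset.card_le_one]
      -- At a singular `v` the restriction to this line is `x * polar F q v + eval q F`. Two roots
      -- would kill both coefficients, and `F` would vanish on the span of `v` and `q`.
      intro x₁ hx₁ x₂ hx₂
      simp only [Finset.mem_filter, Finset.mem_univ, true_and] at hx₁ hx₂
      have hli := linearIndependent_pair_of_triple hu h0
      generalize y • w + z • u = q at *
      obtain ⟨s, t, hst⟩ := exists_eval_smul_add_smul_ne_zero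
        (by rw [Nat.card_eq_fintype_card, hK]) hF hlin hli
      by_contra hne
      have e₁ := eval_smul_add_smul hF v q x₁ 1
      have e₂ := eval_smul_add_smul hF v q x₂ 1
      rw [one_smul, hFv, hsing, hx₁] at e₁
      rw [one_smul, hFv, hsing, hx₂] at e₂
      have hd : polar F q v = 0 := by
        have : (x₁ - x₂) * polar F q v = 0 := by linear_combination e₂ - e₁
        exact (mul_eq_zero.1 this).resolve_left (sub_ne_zero.2 hne)
      rw [hd] at e₁
      have hq : eval q F = 0 := by linear_combination -e₁
      exact hst (by rw [eval_smul_add_smul hF, hFv, hsing, hd, hq]; ring)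
  have h1 := Finset.sum_le_sum hle
  rw [hsum, hN] at h1
  have h2 : ∑ p : K × K, (if p = 0 then 4 else 1) ≤ ∑ p : K × K, ((if p = 0 then 3 else 0) + 1) :=
    Finset.sum_le_sum fun p _ => by split_ifs <;> simp
  -- The bound is 4 multiples of `v` plus one zero on each of the other 15 lines, which is less than
  -- 28.
  have h3 : ∑ p : K × K, ((if p = 0 then 3 else 0) + 1) = 19 := by
    rw [Finset.sum_add_distrib, Finset.sum_ite_eq']
    simp [hK]
  omega

/-! ### Arithmetic of the field with four elements and the normal form at a flex. -/

theorem two_eq_zero_of_card (hK : Nat.card K = 4) : (2 : K) = 0 := by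
  have : Finite K := Nat.finite_of_card_ne_zero (by omega)
  have : Fintype K := Fintype.ofFinite K
  rw [Nat.card_eq_fintype_card] at hK
  have h := Nat.cast_card_eq_zero K
  rw [hK] at h
  have h4 : (2 : K) * 2 = 0 := by rw [← h]; norm_num
  simpa using h4

theorem pow_four_of_card (hK : Nat.card K = 4) (x : K) : x ^ 4 = x := by
  have : Finite K := Nat.finite_of_card_ne_zero (by omega)
  have : Fintype K := Fintype.ofFinite K
  rw [Nat.card_eq_fintype_card] at hK
  rw [← hK, FiniteField.pow_card]

theorem exists_cube_root_of_unity (hK : Nat.card K = 4) : ∃ ω : K, ω ^ 2 + ω + 1 = 0 := by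
  classical
  have : Finite K := Nat.finite_of_card_ne_zero (by omega)
  have : Fintype K := Fintype.ofFinite K
  have hK' := hK
  rw [Nat.card_eq_fintype_card] at hK'
  obtain ⟨ω, -, hω⟩ := Finset.exists_mem_notMem_of_card_lt_card (s := {0, 1})
    (t := (Finset.univ : Finset K)) (by
      rw [Finset.card_univ, hK']
      exact Finset.card_le_two.trans_lt (by norm_num))
  simp only [Finset.mem_insert, Finset.mem_singleton, not_or] at hω
  refine ⟨ω, ?_⟩
  have h : ω * (ω - 1) * (ω ^ 2 + ω + 1) = 0 := by
    linear_combination pow_four_of_card hK ω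
  exact (mul_eq_zero.1 h).resolve_left (mul_ne_zero hω.1 (sub_ne_zero.2 hω.2))

/-- A flex tangent to a cubic without linear components: in coordinates adapted to the flag, the
cubic takes the form `a y³ + a x² z + z (c x y + e x z + d y² + f y z + h z²)`. -/
theorem exists_flex_coordinates (hK : Nat.card K = 4) {F : MvPolynomial (Fin 3) K}
    (hF : F.IsHomogeneous 3) (hlin : ¬ HasLinearComponent F) {v w : Fin 3 → K}
    (hvw : LinearIndependent K ![v, w]) (hFv : eval v F = 0) (hvw0 : polar F v w = 0)
    (hwv0 : polar F w v = 0) (hsm : ∃ u, polar F v u ≠ 0) :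
    ∃ u, LinearIndependent K ![v, w, u] ∧ ∃ a b c d e f : K, a ≠ 0 ∧ ∀ x y z : K,
      eval (x • v + (y • w + z • u)) F = a * (y ^ 3 + x ^ 2 * z + b * (y ^ 2 * z) +
        c * (y * z ^ 2) + d * z ^ 3 + e * (x * z ^ 2) + f * (x * y * z)) := by
  have hvv : polar F v v = 0 := by rw [polar_self hF, hFv, mul_zero]
  -- On the span of `v` and `w` only the term `t³ * eval w F` survives, so it cannot be zero.
  have ha : eval w F ≠ 0 := by
    obtain ⟨s, t, hst⟩ := exists_eval_smul_add_smul_ne_zero hK hF hlin hvw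
    intro h0
    exact hst (by rw [eval_smul_add_smul hF, hFv, hvw0, hwv0, h0]; ring)
  obtain ⟨u₀, hu₀⟩ := hsm
  set a := eval w F with ha'
  -- Scaling makes the coefficient of `x²z` equal to that of `y³`.
  let u : Fin 3 → K := (a / polar F v u₀) • u₀
  have hu : polar F v u = a := by
    rw [polar_smul, div_mul_cancel₀ _ hu₀]
  refine ⟨u, ?_, ?_⟩
  · rw [linearIndependent_triple_iff]
    intro r s t h
    have ht : t = 0 := by
      have h1 : polar F v (r • v + (s • w + t • u)) = 0 := by rw [h]; simp [polar, -eval_zero]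
      rw [polar_add, polar_add, polar_smul, polar_smul, polar_smul, hvv, hvw0, hu] at h1
      simpa [ha] using h1
    subst ht
    rw [zero_smul, add_zero] at h
    have := LinearIndependent.pair_iff.1 hvw r s h
    exact ⟨this.1, this.2, rfl⟩
  · obtain ⟨k, hk⟩ := eval_triple hF v w u
    refine ⟨a, polar F w u / a, polar F u w / a, eval u F / a, polar F u v / a, k / a, ha,
      fun x y z => ?_⟩
    rw [hk, hFv, hvw0, hwv0, hu, ← ha']
    field_simp
    ring

theorem card_quadratic_zeros_le_two [Fintype K] [DecidableEq K] {a b c : K} (ha : a ≠ 0) :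
    (Finset.univ.filter fun x : K => a * x ^ 2 + b * x + c = 0).card ≤ 2 := by
  by_contra! h
  obtain ⟨x, hx, y, hy, z, hz, hxy, hxz, hyz⟩ := Finset.two_lt_card.1 h
  simp only [Finset.mem_filter, Finset.mem_univ, true_and] at hx hy hz
  have h1 : a * (x + y) + b = 0 := by
    refine (mul_eq_zero.1 ?_).resolve_left (sub_ne_zero.2 hxy)
    linear_combination hx - hy
  have h2 : a * (x + z) + b = 0 := by
    refine (mul_eq_zero.1 ?_).resolve_left (sub_ne_zero.2 hxz)
    linear_combination hx - hz
  have h3 : a * (y - z) = 0 := by linear_combination h1 - h2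
  exact (mul_ne_zero ha (sub_ne_zero.2 hyz)) h3

/-- A Weierstrass cubic with nine points over the field with four elements: every vertical line
contains two affine points. -/
theorem card_vertical_fiber (hK : Nat.card K = 4) [Fintype K] [DecidableEq K]
    {F : MvPolynomial (Fin 3) K}
    (hN : {x : Fin 3 → K | eval x F = 0}.ncard = 28) {v w u : Fin 3 → K}
    (hli : LinearIndependent K ![v, w, u]) {a b c d e f : K} (ha : a ≠ 0)
    (h : ∀ x y z : K,
      eval (x • v + (y • w + z • u)) F = a * (y ^ 3 + x ^ 2 * z + b * (y ^ 2 * z) +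
        c * (y * z ^ 2) + d * z ^ 3 + e * (x * z ^ 2) + f * (x * y * z))) (y : K) :
    (Finset.univ.filter fun x : K =>
      x ^ 2 + (e + f * y) * x + (y ^ 3 + b * y ^ 2 + c * y + d) = 0).card = 2 := by
  have hK' := hK
  rw [Nat.card_eq_fintype_card] at hK'
  have hsum := sum_card_fibers F hli
  rw [hN] at hsum
  -- For `z = 0` the form is `a y³`, so only multiples of `v` are zeros. For `z ≠ 0` it is quadratic
  -- in `x`. The total bound 4 + 12·2 = 28 is attained, so every quadratic has two roots.
  have hle : ∀ p ∈ (Finset.univ : Finset (K × K)), (Finset.univ.filter fun x : K =>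
      eval (x • v + (p.1 • w + p.2 • u)) F = 0).card ≤
        (if p = 0 then 4 else 0) + if p.2 = 0 then 0 else 2 := by
    rintro ⟨y, z⟩ -
    by_cases hz : z = 0
    · by_cases hy : y = 0
      · simpa [hy, hz, hK'] using Finset.card_le_univ (α := K) _
      · have h0 (x : K) : eval (x • v + (y • w + (0 : K) • u)) F ≠ 0 := by
          rw [h]
          simp [ha, hy]
        simp only [hz, h0, Finset.filter_false, Finset.card_empty, zero_le]
    · have := card_quadratic_zeros_le_two (a := a * z) (b := a * (e * z ^ 2 + f * y * z))
        (c := a * (y ^ 3 + b * (y ^ 2 * z) + c * (y * z ^ 2) + d * z ^ 3)) (mul_ne_zero ha hz)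
      simp only [h, hz, Prod.mk_eq_zero, and_false, if_false, zero_add]
      convert this using 5
      ring
  have h3 : ∑ p : K × K, ((if p = 0 then 4 else 0) + if p.2 = 0 then 0 else 2) = 28 := by
    rw [Finset.sum_add_distrib, Finset.sum_ite_eq', Fintype.sum_prod_type]
    simp [Finset.sum_ite, Finset.filter_ne', hK']
  have heq := (Finset.sum_eq_sum_iff_of_le hle).1 (hsum.trans h3.symm) (y, 1) (Finset.mem_univ _)
  simp only [h, Prod.mk_eq_zero, one_ne_zero, and_false, if_false, zero_add] at heq
  refine Eq.trans (congrArg Finset.card ?_) heq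
  ext x
  simp only [Finset.mem_filter, Finset.mem_univ, true_and, mul_eq_zero, ha, false_or]
  ring_nf

/-- The Weierstrass coefficients of a cubic over the field with four elements all of whose
vertical lines contain two affine points. -/
theorem weierstrass_coeffs (hK : Nat.card K = 4) [Fintype K] [DecidableEq K] {b c d e f : K}
    (h : ∀ y : K, (Finset.univ.filter fun x : K =>
      x ^ 2 + (e + f * y) * x + (y ^ 3 + b * y ^ 2 + c * y + d) = 0).card = 2) :
    e = 1 ∧ f = 0 ∧ c = b ^ 2 := by
  have h2 := two_eq_zero_of_card hK
  -- In characteristic 2 a quadratic without linear term has at most one root. Hence `e + f y` has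
  -- no zero, which forces `f = 0`.
  have hne : ∀ y, e + f * y ≠ 0 := by
    intro y h0
    obtain ⟨x₁, x₂, hx, he⟩ := Finset.card_eq_two.1 (h y)
    have h₁ : x₁ ∈ ({x₁, x₂} : Finset K) := by simp
    have h₂ : x₂ ∈ ({x₁, x₂} : Finset K) := by simp
    rw [← he, Finset.mem_filter] at h₁ h₂
    have : (x₁ - x₂) ^ 2 = 0 := by
      linear_combination h₁.2 - h₂.2 - (x₁ - x₂) * h0 + (x₂ ^ 2 - x₁ * x₂) * h2
    exact hx (sub_eq_zero.1 (pow_eq_zero_iff two_ne_zero |>.1 this))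
  have hf : f = 0 := by
    by_contra hf
    exact hne (-e / f) (by field_simp; ring)
  subst hf
  have he : e ≠ 0 := by simpa using hne 0
  have he3 : e ^ 3 = 1 := by
    refine mul_left_cancel₀ he ?_
    linear_combination pow_four_of_card hK e
  -- A root exists, so the cubic in `y` takes values of the form `x² + e x`. These satisfy `p² = e²
  -- p` because `x⁴ = x` and `e³ = 1`.
  have hP : ∀ y : K, (y ^ 3 + b * y ^ 2 + c * y + d) ^ 2 =
      e ^ 2 * (y ^ 3 + b * y ^ 2 + c * y + d) := by
    intro y
    obtain ⟨x, hx⟩ : (Finset.univ.filter fun x : K =>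
      x ^ 2 + (e + 0 * y) * x + (y ^ 3 + b * y ^ 2 + c * y + d) = 0).Nonempty := by
      rw [← Finset.card_pos, h]; norm_num
    simp only [Finset.mem_filter, Finset.mem_univ, true_and] at hx
    have hp : y ^ 3 + b * y ^ 2 + c * y + d = x ^ 2 + e * x := by
      linear_combination hx - (x ^ 2 + e * x) * h2
    rw [hp]
    linear_combination pow_four_of_card hK x + e * x ^ 3 * h2 - x * he3
  obtain ⟨ω, hω⟩ := exists_cube_root_of_unity hK
  have hω3 : ω ^ 3 = 1 := by linear_combination (ω - 1) * hω
  have h0 := hP 0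
  have h1 := hP 1
  have hω1 := hP ω
  have hω2 := hP (ω ^ 2)
  have hd : d ^ 2 = e ^ 2 * d := by linear_combination h0
  -- For `y = 1, ω, ω²` one has `y³ = 1`, and the constant terms cancel by `hd`. Adding the three
  -- equations isolates `e² = 1`; the others then give `c = b²`.
  have h1' : 1 + b ^ 2 + c ^ 2 = e ^ 2 * (1 + b + c) := by
    linear_combination h1 - hd - (b + c + d + b * c + b * d + c * d) * h2
  have hω1' : 1 + b ^ 2 * ω + c ^ 2 * ω ^ 2 = e ^ 2 * (1 + b * ω ^ 2 + c * ω) := by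
    grind
  have hω2' : 1 + b ^ 2 * ω ^ 2 + c ^ 2 * ω = e ^ 2 * (1 + b * ω + c * ω ^ 2) := by
    grind
  have he2 : e ^ 2 = 1 := by
    grind
  have he1 : e = 1 := by
    have : (e - 1) ^ 2 = 0 := by linear_combination he2 - (e - 1) * h2
    exact sub_eq_zero.1 (pow_eq_zero_iff two_ne_zero |>.1 this)
  refine ⟨he1, rfl, ?_⟩
  grind

/-- A plane cubic over the field with four elements that has nine points, no linear components
and a rational flex is the Hermitian curve `x² z + x z² + y³ = 0` in suitable coordinates. -/
theorem exists_hermitian_coordinates (hK : Nat.card K = 4) {F : MvPolynomial (Fin 3) K}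
    (hF : F.IsHomogeneous 3) (hlin : ¬ HasLinearComponent F)
    (hN : {x : Fin 3 → K | eval x F = 0}.ncard = 28) {v w : Fin 3 → K}
    (hvw : LinearIndependent K ![v, w]) (hFv : eval v F = 0) (hvw0 : polar F v w = 0)
    (hwv0 : polar F w v = 0) :
    ∃ u, LinearIndependent K ![v, w, u] ∧ ∃ a : K, a ≠ 0 ∧ ∀ x y z : K,
      eval (x • v + (y • w + z • u)) F = a * (y ^ 3 + x ^ 2 * z + x * z ^ 2) := by
  classical
  have : Finite K := Nat.finite_of_card_ne_zero (by omega)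
  have : Fintype K := Fintype.ofFinite K
  have h2 := two_eq_zero_of_card hK
  have hv : v ≠ 0 := hvw.ne_zero 0
  obtain ⟨u, hu, a, b, c, d, e, f, ha, h⟩ := exists_flex_coordinates hK hF hlin hvw hFv hvw0 hwv0
    (exists_polar_ne_zero hK hF hlin hN hv hFv)
  have hfib := card_vertical_fiber hK hN hu ha h
  obtain ⟨rfl, rfl, rfl⟩ := weierstrass_coeffs hK hfib
  obtain ⟨k, hk⟩ : (Finset.univ.filter fun x : K => x ^ 2 + (1 + 0 * b) * x +
      (b ^ 3 + b * b ^ 2 + b ^ 2 * b + d) = 0).Nonempty := by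
    rw [← Finset.card_pos, hfib]; norm_num
  simp only [Finset.mem_filter, Finset.mem_univ, true_and] at hk
  -- The shift by `b` completes the cube, and `k`, a root of the fibre over `y = b`, removes the
  -- `z³` term.
  refine ⟨u + b • w + k • v, ?_, a, ha, fun x y z => ?_⟩
  · rw [linearIndependent_triple_iff] at hu ⊢
    intro r s t hrst
    obtain ⟨h0, h1, h3⟩ := hu (r + t * k) (s + t * b) t (by rw [← hrst]; module)
    subst h3
    simpa using And.intro h0 h1
  · have e : x • v + (y • w + z • (u + b • w + k • v)) =
        (x + k * z) • v + ((y + b * z) • w + z • u) := by module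
    rw [e, h]
    linear_combination a * z ^ 3 * hk + a * (2 * b * y ^ 2 * z + 3 * b ^ 2 * y * z ^ 2 +
      x * k * z ^ 2) * h2

/-- A plane cubic over the field with four elements that has nine points, no linear components
and a rational flex is the Fermat cubic in suitable coordinates. -/
theorem exists_fermat_coordinates (hK : Nat.card K = 4) {F : MvPolynomial (Fin 3) K}
    (hF : F.IsHomogeneous 3) (hlin : ¬ HasLinearComponent F)
    (hN : {x : Fin 3 → K | eval x F = 0}.ncard = 28) {v w : Fin 3 → K}
    (hvw : LinearIndependent K ![v, w]) (hFv : eval v F = 0) (hvw0 : polar F v w = 0)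
    (hwv0 : polar F w v = 0) :
    ∃ u : Fin 3 → Fin 3 → K, LinearIndependent K ![u 0, u 1, u 2] ∧ ∃ a : K, a ≠ 0 ∧ ∀ x y z : K,
      eval (x • u 0 + (y • u 1 + z • u 2)) F = a * (x ^ 3 + y ^ 3 + z ^ 3) := by
  have h2 := two_eq_zero_of_card hK
  obtain ⟨ω, hω⟩ := exists_cube_root_of_unity hK
  obtain ⟨u, hu, a, ha, h⟩ := exists_hermitian_coordinates hK hF hlin hN hvw hFv hvw0 hwv0
  -- The new coordinates have sum `x + z` and product `x² + xz + z²`, so `xz(x + z)` turns into `x³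
  -- + z³`.
  refine ⟨![ω • v + ω ^ 2 • u, w, ω ^ 2 • v + ω • u], ?_, a, ha, fun x y z => ?_⟩
  · simp only [Matrix.cons_val]
    rw [linearIndependent_triple_iff] at hu ⊢
    intro r s t hrst
    obtain ⟨h0, h1, h3⟩ := hu (r * ω + t * ω ^ 2) s (r * ω ^ 2 + t * ω) (by rw [← hrst]; module)
    refine ⟨?_, h1, ?_⟩ <;> grind
  · have e : x • (ω • v + ω ^ 2 • u) + (y • w + z • (ω ^ 2 • v + ω • u)) =
        (x * ω + z * ω ^ 2) • v + (y • w + (x * ω ^ 2 + z * ω) • u) := by module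
    simp only [Matrix.cons_val]
    rw [e, h]
    grind

end Field

/-! ### Intersection multiplicity with the tangent line. -/

section Length

/-- Such a module is a quotient of the residue field. -/
theorem length_le_one_of_cyclic {R M : Type*} [CommRing R] [IsLocalRing R] [AddCommGroup M]
    [Module R M] (g : M) (hg : Submodule.span R {g} = ⊤)
    (h : ∀ r ∈ IsLocalRing.maximalIdeal R, r • g = 0) : Module.length R M ≤ 1 := by
  have hsimple : IsSimpleModule R (R ⧸ IsLocalRing.maximalIdeal R) :=
    isSimpleModule_iff_isCoatom.2 (IsLocalRing.maximalIdeal.isMaximal R).out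
  let f : (R ⧸ IsLocalRing.maximalIdeal R) →ₗ[R] M :=
    Submodule.liftQ _ (LinearMap.toSpanSingleton R M g) fun r hr => by
      simpa using h r hr
  rw [← Module.length_eq_one R (R ⧸ IsLocalRing.maximalIdeal R)]
  refine Module.length_le_of_surjective f fun x => ?_
  have hx : x ∈ Submodule.span R {g} := hg ▸ Submodule.mem_top
  obtain ⟨r, rfl⟩ := Submodule.mem_span_singleton.1 hx
  exact ⟨Submodule.Quotient.mk r, Submodule.liftQ_apply _ _ _⟩

/-- In a local ring with maximal ideal `(t, m)`, an ideal containing `t` and `m ^ 2` has colength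
at most two. -/
theorem length_quotient_le_two {R : Type*} [CommRing R] [IsLocalRing R] {I : Ideal R} {t m : R}
    (hmax : IsLocalRing.maximalIdeal R ≤ Ideal.span {t, m}) (ht : t ∈ I) (hm : m ^ 2 ∈ I) :
    Module.length R (R ⧸ I) ≤ 2 := by
  -- Both steps of the filtration 0 ⊆ `N` ⊆ `R ⧸ I` have cyclic quotients killed by the maximal
  -- ideal.
  let N : Submodule R (R ⧸ I) := Submodule.span R {Ideal.Quotient.mk I m}
  have hone : ∀ r : R, Ideal.Quotient.mk I r = r • Ideal.Quotient.mk I 1 := fun r => by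
    rw [← Ideal.Quotient.mk_eq_mk, ← Ideal.Quotient.mk_eq_mk, ← Submodule.Quotient.mk_smul,
      smul_eq_mul, mul_one]
  have hsm : ∀ r s : R, r • Ideal.Quotient.mk I s = Ideal.Quotient.mk I (r * s) := fun r s => rfl
  rw [Module.length_eq_add_of_exact N.subtype N.mkQ N.injective_subtype N.mkQ_surjective
    (LinearMap.exact_subtype_mkQ N)]
  have h1 : Module.length R N ≤ 1 := by
    refine length_le_one_of_cyclic (⟨Ideal.Quotient.mk I m, Submodule.mem_span_singleton_self _⟩ : N)
      ?_ fun r hr => ?_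
    · rw [eq_top_iff]
      rintro ⟨x, hx⟩ -
      obtain ⟨r, rfl⟩ := Submodule.mem_span_singleton.1 hx
      exact Submodule.mem_span_singleton.2 ⟨r, rfl⟩
    · obtain ⟨a, b, rfl⟩ := Ideal.mem_span_pair.1 (hmax hr)
      apply Subtype.ext
      change (a * t + b * m) • Ideal.Quotient.mk I m = 0
      rw [hsm, Ideal.Quotient.eq_zero_iff_mem]
      have e : (a * t + b * m) * m = a * m * t + b * m ^ 2 := by ring
      rw [e]
      exact I.add_mem (I.mul_mem_left _ ht) (I.mul_mem_left _ hm)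
  have h2 : Module.length R ((R ⧸ I) ⧸ N) ≤ 1 := by
    refine length_le_one_of_cyclic (N.mkQ (Ideal.Quotient.mk I 1)) ?_ fun r hr => ?_
    · rw [eq_top_iff]
      rintro x -
      obtain ⟨y, rfl⟩ := N.mkQ_surjective x
      obtain ⟨r, rfl⟩ := Ideal.Quotient.mk_surjective y
      exact Submodule.mem_span_singleton.2 ⟨r, by rw [hone r, map_smul]⟩
    · rw [← map_smul, ← hone]
      obtain ⟨a, b, rfl⟩ := Ideal.mem_span_pair.1 (hmax hr)
      have e : Ideal.Quotient.mk I (a * t + b * m) = b • Ideal.Quotient.mk I m := by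
        rw [hsm, Ideal.Quotient.eq]
        simpa using I.mul_mem_left a ht
      rw [e, Submodule.mkQ_apply, Submodule.Quotient.mk_eq_zero]
      exact N.smul_mem _ (Submodule.mem_span_singleton_self _)
  exact (add_le_add h1 h2).trans (by norm_num)

end Length

section Field

variable {K : Type*} [Field K]

theorem linearForm_mem_vectorIdeal {l v : Fin 3 → K} :
    linearForm l ∈ vectorIdeal v ↔ eval v (linearForm l) = 0 := by
  have : aeval (R := K) (fun i => Polynomial.C (v i) * Polynomial.X) (linearForm l) =
      Polynomial.C (eval v (linearForm l)) * Polynomial.X := by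
    simp [linearForm, Fin.sum_univ_three]
    ring
  rw [vectorIdeal, RingHom.mem_ker]
  change aeval (R := K) (fun i => Polynomial.C (v i) * Polynomial.X) (linearForm l) = 0 ↔ _
  rw [this]
  simp only [mul_eq_zero, Polynomial.X_ne_zero, or_false, Polynomial.C_eq_zero]

theorem linearForm_ext {p q : MvPolynomial (Fin 3) K} (hp : p.IsHomogeneous 1)
    (hq : q.IsHomogeneous 1) (h : ∀ x, eval x p = eval x q) : p = q :=
  hp.funext_of_le_card hq h (by
    rw [Nat.cast_one, Cardinal.one_le_iff_ne_zero]
    exact Cardinal.mk_ne_zero K)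

/-- The ideal of a point is generated by two linear forms. -/
theorem vectorIdeal_le_span {v w u : Fin 3 → K} {n : Fin 3 → Fin 3 → K}
    (hn : ∀ x, x = eval x (linearForm (n 0)) • v +
      (eval x (linearForm (n 1)) • w + eval x (linearForm (n 2)) • u)) :
    vectorIdeal v ≤ Ideal.span {linearForm (n 2), linearForm (n 1)} := by
  intro G hG
  rw [vectorIdeal, RingHom.mem_ker] at hG
  set J := Ideal.span {linearForm (n 2), linearForm (n 1)}
  -- Modulo `J` each `X i` equals `v i` times the form `n 0`, so reduction modulo `J` factors
  -- through restriction to the line spanned by `v`.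
  have hom : Ideal.Quotient.mkₐ K J = ((Ideal.Quotient.mkₐ K J).comp
      (Polynomial.aeval (linearForm (n 0)))).comp
        (aeval (R := K) fun i => Polynomial.C (v i) * Polynomial.X) := by
    ext i : 1
    have hX : (X i : MvPolynomial (Fin 3) K) - C (v i) * linearForm (n 0) =
        C (u i) * linearForm (n 2) + C (w i) * linearForm (n 1) := by
      have hC : ∀ (c : K) j, (C c * linearForm (n j)).IsHomogeneous 1 := fun c j =>
        (isHomogeneous_linearForm _).C_mul c
      refine linearForm_ext ((isHomogeneous_X K i).sub (hC _ _)) ((hC _ _).add (hC _ _))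
        fun x => ?_
      have := congrFun (hn x) i
      simp only [Pi.add_apply, Pi.smul_apply, smul_eq_mul] at this
      simp only [map_sub, map_add, map_mul, eval_X, eval_C]
      linear_combination this
    have hmem : (X i : MvPolynomial (Fin 3) K) - C (v i) * linearForm (n 0) ∈ J :=
      Ideal.mem_span_pair.2 ⟨C (u i), C (w i), hX.symm⟩
    have := Ideal.Quotient.eq.2 hmem
    simpa [MvPolynomial.algebraMap_eq] using this
  have := DFunLike.congr_fun hom G
  rw [AlgHom.comp_apply] at this
  have h0 : aeval (R := K) (fun i => Polynomial.C (v i) * Polynomial.X) G = 0 := hG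
  rw [h0, map_zero] at this
  exact Ideal.Quotient.eq_zero_iff_mem.1 this

/-- A smooth point at which the tangent line is not a flex tangent has intersection multiplicity
at most two with the tangent line. -/
theorem intersectionMultiplicity_le_two (hK : Nat.card K = 4) {F : MvPolynomial (Fin 3) K}
    (hF : F.IsHomogeneous 3) {P : ℙ K (Fin 3 → K)} {w u : Fin 3 → K}
    (hli : LinearIndependent K ![P.rep, w, u]) (hP : eval P.rep F = 0)
    (hw : polar F P.rep w = 0) (hu : polar F P.rep u ≠ 0) (hwv : polar F w P.rep ≠ 0) :
    intersectionMultiplicity (tangentLine F P) F P ≤ 2 := by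
  obtain ⟨n, hn⟩ := exists_dual_basis hli
  have happ := dual_basis_apply hli hn
  have hvv : polar F P.rep P.rep = 0 := by rw [polar_self hF, hP, mul_zero]
  have hT : tangentLine F P = C (polar F P.rep u) * linearForm (n 2) := by
    refine linearForm_ext (isHomogeneous_linearForm _) ((isHomogeneous_linearForm _).C_mul _)
      fun x => ?_
    change polar F P.rep x = _
    rw [hn x, polar_add, polar_add, polar_smul, polar_smul, polar_smul, hw, hvv, ← hn x]
    simp only [map_mul, eval_C]
    ring
  -- On the tangent plane `n 2 = 0` the cubic equals `t² (s * polar F w P.rep + t * eval w F)`. The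
  -- second factor is `U`, a unit at `P`.
  let U := linearForm (polar F w P.rep • n 0 + eval w F • n 1)
  have hU : ∀ x, eval x U = polar F w P.rep * eval x (linearForm (n 0)) +
      eval w F * eval x (linearForm (n 1)) := by
    intro x; simp [U]; ring
  have hn2 : n 2 ≠ 0 := by
    intro h0
    have := (happ 0 0 1).2.2
    rw [h0] at this
    simp at this
  have hdvd : linearForm (n 2) ∣ F - linearForm (n 1) ^ 2 * U := by
    refine linearForm_dvd_of_forall_eval hK (hF.sub ?_) hn2 fun x hx => ?_
    · exact ((isHomogeneous_linearForm _).pow 2).mul (isHomogeneous_linearForm _)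
    · have hx' := hn x
      rw [hx, zero_smul, add_zero] at hx'
      simp only [map_sub, map_mul, map_pow, hU]
      generalize eval x (linearForm (n 0)) = s at *
      generalize eval x (linearForm (n 1)) = t at *
      rw [hx', eval_smul_add_smul hF, hP, hw]
      ring
  set p := pointIdeal P
  set R := Localization.AtPrime p
  have hUp : U ∉ p := by
    intro h
    have h1 := linearForm_mem_vectorIdeal.1 h
    have h2 := happ 1 0 0
    simp only [one_smul, zero_smul, add_zero] at h2
    change eval P.rep U = 0 at h1
    rw [hU, h2.1, h2.2.1] at h1
    exact hwv (by simpa using h1)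
  set I : Ideal R := (Ideal.span {tangentLine F P, F}).map (algebraMap _ R)
  have hTI : algebraMap _ R (linearForm (n 2)) ∈ I := by
    have : linearForm (n 2) = C (polar F P.rep u)⁻¹ * tangentLine F P := by
      rw [hT, ← mul_assoc, ← C_mul, inv_mul_cancel₀ hu, C_1, one_mul]
    rw [this]
    exact Ideal.mem_map_of_mem _ (Ideal.mul_mem_left _ _ (Ideal.subset_span (by simp)))
  refine length_quotient_le_two (t := algebraMap _ R (linearForm (n 2)))
    (m := algebraMap _ R (linearForm (n 1))) ?_ hTI ?_
  · rw [← Localization.AtPrime.map_eq_maximalIdeal, ← Set.image_pair, ← Ideal.map_span]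
    exact Ideal.map_mono (vectorIdeal_le_span hn)
  · have hunit : IsUnit (algebraMap _ R U) :=
      IsLocalization.map_units R (⟨U, hUp⟩ : p.primeCompl)
    rw [← Ideal.mul_unit_mem_iff_mem I hunit, ← map_pow, ← map_mul]
    obtain ⟨Q, hQ⟩ := hdvd
    have : linearForm (n 1) ^ 2 * U = F - linearForm (n 2) * Q := by rw [← hQ]; ring
    rw [this, map_sub, map_mul]
    exact I.sub_mem (Ideal.mem_map_of_mem _ (Ideal.subset_span (by simp)))
      (I.mul_mem_right _ hTI)

/-- `polar F v` is a nonzero functional on a 3-space that kills `v`; its kernel is a plane, spanned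
by `v` and the tangent direction `w`. -/
theorem exists_tangent_direction {F : MvPolynomial (Fin 3) K} {v : Fin 3 → K}
    (hv : v ≠ 0) (h : ∃ w, polar F v w ≠ 0) (hvv : polar F v v = 0) :
    ∃ w u, LinearIndependent K ![v, w, u] ∧ polar F v w = 0 ∧ polar F v u ≠ 0 := by
  obtain ⟨w, hw⟩ := exists_linearIndependent_pair hv
  obtain ⟨u, hu⟩ := exists_linearIndependent_triple hw
  by_cases hu0 : polar F v u = 0
  · refine ⟨u, w, ?_, hu0, fun hw0 => ?_⟩
    · rw [linearIndependent_triple_iff] at hu ⊢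
      intro a b c habc
      obtain ⟨h0, h1, h2⟩ := hu a c b (by rw [← habc]; module)
      exact ⟨h0, h2, h1⟩
    · obtain ⟨n, hn⟩ := exists_dual_basis hu
      obtain ⟨x, hx⟩ := h
      apply hx
      rw [hn x, polar_add, polar_add, polar_smul, polar_smul, polar_smul, hvv, hu0, hw0]
      ring
  · refine ⟨w + (-(polar F v w / polar F v u)) • u, u, ?_, ?_, hu0⟩
    · rw [linearIndependent_triple_iff] at hu ⊢
      intro a b c habc
      obtain ⟨h0, h1, h2⟩ := hu a b (b * (-(polar F v w / polar F v u)) + c) (by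
        rw [← habc]; module)
      subst h1
      exact ⟨h0, rfl, by simpa using h2⟩
    · rw [polar_add, polar_smul]
      field_simp
      ring

end Field

/-! ### Absolute irreducibility. -/

theorem totalDegree_sub_homogeneousComponent_lt {σ R : Type*} [CommRing R]
    {A : MvPolynomial σ R} {a : ℕ} (hA : A.totalDegree ≤ a) (ha : 0 < a) :
    (A - homogeneousComponent a A).totalDegree < a := by
  rw [totalDegree, Finset.sup_lt_iff ha]
  intro m hm
  rw [mem_support_iff, coeff_sub, coeff_homogeneousComponent] at hm
  split_ifs at hm with h
  · simp at hm
  · rw [sub_zero] at hm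
    have h1 := le_totalDegree (mem_support_iff.2 hm)
    rw [Finsupp.degree_apply] at h
    simp only [Finsupp.sum] at h1 ⊢
    omega

/-- The factors of a homogeneous polynomial may be replaced by their leading forms. -/
theorem eq_mul_homogeneousComponent {σ R : Type*} [CommRing R]
    {G A B : MvPolynomial σ R} {a b : ℕ} (ha : 0 < a) (hb : 0 < b)
    (hG : G.IsHomogeneous (a + b)) (h : G = A * B) (hA : A.totalDegree ≤ a)
    (hB : B.totalDegree ≤ b) : G = homogeneousComponent a A * homogeneousComponent b B := by
  have hA' := totalDegree_sub_homogeneousComponent_lt hA ha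
  have hB' := totalDegree_sub_homogeneousComponent_lt hB hb
  have hAa := homogeneousComponent_isHomogeneous a A
  have hBb := homogeneousComponent_isHomogeneous b B
  have e : A * B = homogeneousComponent a A * homogeneousComponent b B +
      (homogeneousComponent a A * (B - homogeneousComponent b B) +
        (A - homogeneousComponent a A) * B) := by ring
  have h0 : homogeneousComponent (a + b) (homogeneousComponent a A *
      (B - homogeneousComponent b B) + (A - homogeneousComponent a A) * B) = 0 := by
    rw [map_add, homogeneousComponent_eq_zero, homogeneousComponent_eq_zero, add_zero]
    · exact (totalDegree_mul _ _).trans_lt (add_lt_add_of_lt_of_le hA' hB)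
    · exact (totalDegree_mul _ _).trans_lt (add_lt_add_of_le_of_lt hAa.totalDegree_le hB')
  have h1 := homogeneousComponent_eq_self hG
  rw [← h1, h, e, map_add, h0, add_zero, homogeneousComponent_eq_self (hAa.mul hBb)]

theorem irreducible_linearForm {L : Type*} [Field L] {l : Fin 3 → L} (hl : l ≠ 0) :
    Irreducible (linearForm l) := by
  refine irreducible_of_totalDegree_eq_one
    ((isHomogeneous_linearForm l).totalDegree (linearForm_ne_zero hl)) fun x hx => ?_
  obtain ⟨j, hj⟩ := Function.ne_iff.1 hl
  have := hx (Finsupp.single j 1)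
  rw [coeff_linearForm] at this
  rw [isUnit_iff_ne_zero]
  rintro rfl
  exact hj (zero_dvd_iff.1 this)

section Field

variable {K : Type*} [Field K] {L : Type*} [Field L] [Algebra K L]

theorem eval_algebraMap_comp (x : Fin 3 → K) (F : MvPolynomial (Fin 3) K) :
    eval (algebraMap K L ∘ x) (map (algebraMap K L) F) = algebraMap K L (eval x F) := by
  rw [eval_map, ← eval₂_comp]

theorem eval_eq_zero_of_dvd_map {F : MvPolynomial (Fin 3) K} {A : MvPolynomial (Fin 3) L}
    (h : A ∣ map (algebraMap K L) F) {x : Fin 3 → K}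
    (hx : eval (algebraMap K L ∘ x) A = 0) : eval x F = 0 := by
  obtain ⟨B, hB⟩ := h
  have := eval_algebraMap_comp (L := L) x F
  rw [hB, map_mul, hx, zero_mul] at this
  exact (map_eq_zero _).1 this.symm

/-- `z⁴ - z` already splits over `K`, with roots 0, 1, `ω` and `-1 - ω`. -/
theorem mem_range_algebraMap_of_pow_four (hK : Nat.card K = 4) {z : L} (hz : z ^ 4 = z) :
    ∃ r : K, algebraMap K L r = z := by
  obtain ⟨ω, hω⟩ := exists_cube_root_of_unity hK
  have hω' := congrArg (algebraMap K L) hω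
  simp only [map_add, map_pow, map_one, map_zero] at hω'
  have h : z * ((z - 1) * ((z - algebraMap K L ω) * (z + 1 + algebraMap K L ω))) = 0 := by
    linear_combination hz - z * (z - 1) * hω'
  rcases mul_eq_zero.1 h with h | h
  · exact ⟨0, by rw [h, map_zero]⟩
  rcases mul_eq_zero.1 h with h | h
  · exact ⟨1, by rw [map_one]; exact (sub_eq_zero.1 h).symm⟩
  rcases mul_eq_zero.1 h with h | h
  · exact ⟨ω, (sub_eq_zero.1 h).symm⟩
  · exact ⟨-1 - ω, by rw [map_sub, map_neg, map_one]; linear_combination -h⟩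

/-- A line over an extension field that is a component of a cubic without rational linear
components contains at most one rational point. -/
theorem ncard_zeros_linearForm_le (hK : Nat.card K = 4) {F : MvPolynomial (Fin 3) K}
    (hF : F.IsHomogeneous 3) (hlin : ¬ HasLinearComponent F) {l : Fin 3 → L}
    (h : linearForm l ∣ map (algebraMap K L) F) :
    {x : Fin 3 → K | eval (algebraMap K L ∘ x) (linearForm l) = 0}.ncard ≤ 4 := by
  have : Finite K := Nat.finite_of_card_ne_zero (by omega)
  obtain ⟨v, hv⟩ : ∃ v : Fin 3 → K,
      {x : Fin 3 → K | eval (algebraMap K L ∘ x) (linearForm l) = 0} ⊆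
        Set.range fun c : K => c • v := by
    by_cases hz : ∃ v : Fin 3 → K, v ≠ 0 ∧ eval (algebraMap K L ∘ v) (linearForm l) = 0
    · obtain ⟨v, hv0, hv⟩ := hz
      refine ⟨v, fun x hx => ?_⟩
      have hx : eval (algebraMap K L ∘ x) (linearForm l) = 0 := hx
      by_contra hne
      -- Two independent rational zeros of `l` would make `F` vanish on their whole rational span.
      obtain ⟨s, t, hst⟩ := exists_eval_smul_add_smul_ne_zero hK hF hlin
        ((LinearIndependent.pair_iff' hv0).2 fun c hc => hne ⟨c, hc⟩)
      apply hst
      apply eval_eq_zero_of_dvd_map h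
      simp only [eval_linearForm, Function.comp_apply, Pi.add_apply, Pi.smul_apply, smul_eq_mul,
        map_add, map_mul] at hv hx ⊢
      linear_combination algebraMap K L s * hv + algebraMap K L t * hx
    · push Not at hz
      refine ⟨0, fun x hx => ⟨0, ?_⟩⟩
      by_contra hne
      exact hz x (fun h0 => hne (by simp [h0])) hx
  refine (Set.ncard_le_ncard hv (Set.toFinite _)).trans ?_
  rw [← Set.image_univ]
  refine (Set.ncard_image_le (Set.toFinite _)).trans ?_
  rw [Set.ncard_univ, hK]

/-- A linear component that is invariant under Frobenius is rational. -/
theorem not_linearForm_frobenius_dvd (hK : Nat.card K = 4) {F : MvPolynomial (Fin 3) K}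
    (hF : F.IsHomogeneous 3) (hlin : ¬ HasLinearComponent F) {l : Fin 3 → L} (hl : l ≠ 0)
    (h : linearForm l ∣ map (algebraMap K L) F) :
    ¬ linearForm (fun i => l i ^ 4) ∣ linearForm l := by
  rintro ⟨A, hA⟩
  have hl0 := linearForm_ne_zero hl
  have hA0 : A ≠ 0 := by rintro rfl; exact hl0 (by rw [hA, mul_zero])
  have hσ0 : linearForm (fun i => l i ^ 4) ≠ 0 := by
    intro h0; exact hl0 (by rw [hA, h0, zero_mul])
  have hdeg := congrArg totalDegree hA
  rw [totalDegree_mul_of_isDomain hσ0 hA0, (isHomogeneous_linearForm _).totalDegree hl0,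
    (isHomogeneous_linearForm _).totalDegree hσ0] at hdeg
  obtain ⟨c, rfl⟩ : ∃ c, A = C c := ⟨_, totalDegree_eq_zero_iff_eq_C.1 (by omega)⟩
  have hc : ∀ i, l i = l i ^ 4 * c := fun i => by
    have := congrArg (coeff (Finsupp.single i 1)) hA
    rwa [mul_comm, coeff_C_mul, coeff_linearForm, coeff_linearForm, mul_comm] at this
  obtain ⟨j, hj⟩ := Function.ne_iff.1 hl
  rw [Pi.zero_apply] at hj
  have hc0 : c ≠ 0 := by
    rintro rfl
    exact hj (by simpa using hc j)
  -- Proportionality to the conjugate makes each ratio `l i / l j` a fixed point of the fourth power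
  -- map, so `l` is rational up to a scalar.
  have hr : ∀ i, ∃ r : K, algebraMap K L r = l i / l j := fun i => by
    apply mem_range_algebraMap_of_pow_four hK
    rw [div_pow]
    conv_rhs => rw [hc i, hc j]
    rw [mul_div_mul_right _ _ hc0]
  choose r hr using hr
  have hr0 : r ≠ 0 := by
    intro h0
    have := hr j
    rw [h0, div_self hj] at this
    simp at this
  obtain ⟨x, hx, hxF⟩ := exists_eval_ne_zero hK hF hlin hr0
  apply hxF
  apply eval_eq_zero_of_dvd_map h
  have hx' := congrArg (algebraMap K L) hx
  simp only [eval_linearForm, map_add, map_mul, hr, map_zero] at hx'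
  field_simp at hx'
  simp only [eval_linearForm, Function.comp_apply]
  linear_combination hx'

/-- `F` is fixed by Frobenius, so the conjugate of a linear factor divides it too. The two factors
are coprime, a third linear factor remains, and three lines account for at most 12 of the 28 zeros.
-/
theorem not_linearForm_dvd_map (hK : Nat.card K = 4) {F : MvPolynomial (Fin 3) K}
    (hF : F.IsHomogeneous 3) (hF0 : F ≠ 0) (hlin : ¬ HasLinearComponent F)
    (hN : {x : Fin 3 → K | eval x F = 0}.ncard = 28) {l : Fin 3 → L} (hl : l ≠ 0) :
    ¬ linearForm l ∣ map (algebraMap K L) F := by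
  intro h
  have : Finite K := Nat.finite_of_card_ne_zero (by omega)
  have : Fintype K := Fintype.ofFinite K
  have hcard : Fintype.card K = 4 := by rw [← Nat.card_eq_fintype_card, hK]
  let σ : L →ₐ[K] L := FiniteField.frobeniusAlgHom K L
  have hσ : σ.toRingHom ∘ l = fun i => l i ^ 4 := by
    ext i
    simp [σ, hcard]
  have hG0 : map (algebraMap K L) F ≠ 0 := by
    rwa [Ne, map_eq_zero_iff _ (map_injective _ (algebraMap K L).injective)]
  have hG := hF.map (algebraMap K L)
  have hσl : linearForm (fun i => l i ^ 4) ∣ map (algebraMap K L) F := by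
    have := map_dvd (map σ.toRingHom) h
    rw [map_linearForm, hσ, map_map] at this
    have e : σ.toRingHom.comp (algebraMap K L) = algebraMap K L := σ.comp_algebraMap
    rwa [e] at this
  have hσl0 : (fun i => l i ^ 4) ≠ 0 := by
    intro h0
    apply hl
    ext i
    exact pow_eq_zero_iff (n := 4) (by norm_num) |>.1 (congrFun h0 i)
  obtain ⟨Q, hQ⟩ := h
  have hdvdQ := ((irreducible_linearForm hσl0).prime.dvd_or_dvd (hQ ▸ hσl)).resolve_left
    (not_linearForm_frobenius_dvd hK hF hlin hl ⟨Q, hQ⟩)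
  obtain ⟨M, rfl⟩ := hdvdQ
  rw [← mul_assoc] at hQ
  have hM0 : M ≠ 0 := by rintro rfl; exact hG0 (by rw [hQ, mul_zero])
  have hl2 := (isHomogeneous_linearForm l).mul (isHomogeneous_linearForm fun i => l i ^ 4)
  have hl20 := mul_ne_zero (linearForm_ne_zero hl) (linearForm_ne_zero hσl0)
  have hdeg := congrArg totalDegree hQ
  rw [totalDegree_mul_of_isDomain hl20 hM0, hl2.totalDegree hl20, hG.totalDegree hG0] at hdeg
  have hfac := eq_mul_homogeneousComponent (a := 2) (b := 1) (by norm_num) (by norm_num) hG hQ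
    hl2.totalDegree_le (by omega)
  rw [homogeneousComponent_eq_self hl2] at hfac
  obtain ⟨m, hm⟩ := exists_eq_linearForm (homogeneousComponent_isHomogeneous 1 M)
  rw [hm] at hfac
  have h1 := ncard_zeros_linearForm_le hK hF hlin (l := l) ⟨_, by rw [hfac, mul_assoc]⟩
  have h2 := ncard_zeros_linearForm_le hK hF hlin hσl
  have h3 := ncard_zeros_linearForm_le hK hF hlin (l := m) ⟨_, by rw [hfac, mul_comm]⟩
  have hsub : {x : Fin 3 → K | eval x F = 0} ⊆
      ({x : Fin 3 → K | eval (algebraMap K L ∘ x) (linearForm l) = 0} ∪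
        {x | eval (algebraMap K L ∘ x) (linearForm fun i => l i ^ 4) = 0}) ∪
      {x | eval (algebraMap K L ∘ x) (linearForm m) = 0} := by
    intro x hx
    have hx : eval x F = 0 := hx
    have := eval_algebraMap_comp (L := L) x F
    rw [hx, map_zero, hfac, map_mul, map_mul, mul_eq_zero, mul_eq_zero] at this
    exact this
  have h4 := (Set.ncard_le_ncard hsub (Set.toFinite _)).trans (Set.ncard_union_le _ _)
  have h5 := Set.ncard_union_le
    {x : Fin 3 → K | eval (algebraMap K L ∘ x) (linearForm l) = 0}
    {x | eval (algebraMap K L ∘ x) (linearForm fun i => l i ^ 4) = 0}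
  omega

/-- A plane cubic with nine points over the field with four elements and without rational linear
components stays irreducible over every extension field. -/
theorem irreducible_map (hK : Nat.card K = 4) {F : MvPolynomial (Fin 3) K}
    (hF : F.IsHomogeneous 3) (hF0 : F ≠ 0) (hlin : ¬ HasLinearComponent F)
    (hN : {x : Fin 3 → K | eval x F = 0}.ncard = 28) : Irreducible (map (algebraMap K L) F) := by
  have hG0 : map (algebraMap K L) F ≠ 0 := by
    rwa [Ne, map_eq_zero_iff _ (map_injective _ (algebraMap K L).injective)]
  have hG := hF.map (algebraMap K L)
  have hdeg := hG.totalDegree hG0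
  have hno : ∀ A B : MvPolynomial (Fin 3) L, map (algebraMap K L) F = A * B →
      A.totalDegree = 1 → B.totalDegree = 2 → False := by
    intro A B hAB hA hB
    have hfac := eq_mul_homogeneousComponent (a := 1) (b := 2) (by norm_num) (by norm_num) hG hAB
      hA.le hB.le
    obtain ⟨l, hl⟩ := exists_eq_linearForm (homogeneousComponent_isHomogeneous 1 A)
    rw [hl] at hfac
    refine not_linearForm_dvd_map (L := L) (l := l) hK hF hF0 hlin hN ?_ ⟨_, hfac⟩
    rintro rfl
    exact hG0 (by rw [hfac]; simp [linearForm])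
  have hunit : ∀ A : MvPolynomial (Fin 3) L, A ≠ 0 → A.totalDegree = 0 → IsUnit A := by
    intro A hA0 hA
    obtain ⟨c, rfl⟩ : ∃ c, A = C c := ⟨_, totalDegree_eq_zero_iff_eq_C.1 hA⟩
    exact (isUnit_iff_ne_zero.2 fun h0 => hA0 (by rw [h0, C_0])).map C
  refine ⟨fun h => ?_, fun A B hAB => ?_⟩
  · rw [isUnit_iff_totalDegree_of_isReduced] at h
    omega
  · have hA0 : A ≠ 0 := by rintro rfl; exact hG0 (by rw [hAB, zero_mul])
    have hB0 : B ≠ 0 := by rintro rfl; exact hG0 (by rw [hAB, mul_zero])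
    have hsum := hdeg
    rw [hAB, totalDegree_mul_of_isDomain hA0 hB0] at hsum
    by_contra! hnu
    have hA1 : A.totalDegree ≠ 0 := fun h => hnu.1 (hunit A hA0 h)
    have hB1 : B.totalDegree ≠ 0 := fun h => hnu.2 (hunit B hB0 h)
    obtain ⟨h1, h2⟩ | ⟨h1, h2⟩ : (A.totalDegree = 1 ∧ B.totalDegree = 2) ∨
        (B.totalDegree = 1 ∧ A.totalDegree = 2) := by omega
    · exact hno A B hAB h1 h2
    · exact hno B A (by rw [hAB, mul_comm]) h1 h2

/-! ### From Fermat coordinates to the conclusion. -/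

/-- If a cubic is a Fermat cubic on the vectors of a rational coordinate system, then it is
Hermitian and projectively equivalent to the Fermat cubic. -/
theorem hermitian_of_fermat_coordinates (hK : Nat.card K = 4) {F : MvPolynomial (Fin 3) K}
    (hF : F.IsHomogeneous 3) {u : Fin 3 → Fin 3 → K} (hu : LinearIndependent K ![u 0, u 1, u 2])
    {a : K} (ha : a ≠ 0) (h : ∀ x y z : K,
      eval (x • u 0 + (y • u 1 + z • u 2)) F = a * (x ^ 3 + y ^ 3 + z ^ 3)) :
    IsHermitianCurve 2 F ∧ ProjectivelyEquivalent F (X 0 ^ 3 + X 1 ^ 3 + X 2 ^ 3) := by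
  have : Finite K := Nat.finite_of_card_ne_zero (by omega)
  have hle : ((3 : ℕ) : Cardinal) ≤ Cardinal.mk K := by
    rw [← Nat.cast_card, hK]; norm_num
  obtain ⟨n, hn⟩ := exists_dual_basis hu
  constructor
  · refine ⟨a⁻¹, inv_ne_zero ha, Matrix.of fun i j => ∑ k, n k i ^ 2 * n k j, ?_, ?_⟩
    · have h2 := two_eq_zero_of_card hK
      have h4 := pow_four_of_card hK
      ext i j
      simp only [Matrix.transpose_apply, Matrix.map_apply, Matrix.of_apply, Fin.sum_univ_three]
      have e : ∀ p q r : K, (p + q + r) ^ 2 = p ^ 2 + q ^ 2 + r ^ 2 := fun p q r => by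
        linear_combination (p * q + p * r + q * r) * h2
      have e' : ∀ k, (n k i ^ 2 * n k j) ^ 2 = n k j ^ 2 * n k i := fun k => by
        linear_combination n k j ^ 2 * h4 (n k i)
      rw [e, e', e', e']
    · have hpow : ∀ k, (linearForm (n k) ^ 3).IsHomogeneous 3 := fun k =>
        (isHomogeneous_linearForm (n k)).pow 3
      have hFF : C a⁻¹ * F = linearForm (n 0) ^ 3 + linearForm (n 1) ^ 3 + linearForm (n 2) ^ 3 := by
        refine (hF.C_mul _).funext_of_le_card (((hpow 0).add (hpow 1)).add (hpow 2))
          (fun x => ?_) hle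
        have := h (eval x (linearForm (n 0))) (eval x (linearForm (n 1)))
          (eval x (linearForm (n 2)))
        rw [← hn x] at this
        rw [map_mul, this, eval_C, inv_mul_cancel_left₀ ha]
        simp only [map_add, map_pow]
      have h2 : (2 : MvPolynomial (Fin 3) K) = 0 := by
        rw [← map_ofNat C, two_eq_zero_of_card hK, C_0]
      have hcube : ∀ k, linearForm (n k) ^ 3 =
          (X 0 ^ 2 * C (n k 0) ^ 2 + X 1 ^ 2 * C (n k 1) ^ 2 + X 2 ^ 2 * C (n k 2) ^ 2) *
            (C (n k 0) * X 0 + C (n k 1) * X 1 + C (n k 2) * X 2) := fun k => by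
        rw [linearForm, Fin.sum_univ_three]
        linear_combination (C (n k 0) * X 0 + C (n k 1) * X 1 + C (n k 2) * X 2) *
          (C (n k 0) * X 0 * (C (n k 1) * X 1) + C (n k 0) * X 0 * (C (n k 2) * X 2) +
            C (n k 1) * X 1 * (C (n k 2) * X 2)) * h2
      rw [hFF, hcube, hcube, hcube]
      simp only [Fin.sum_univ_three, Matrix.of_apply, map_add, map_mul, map_pow]
      ring
  · let M : Matrix (Fin 3) (Fin 3) K := (Matrix.of ![u 0, u 1, u 2]).transpose
    have hM : IsUnit M := by
      rw [← Matrix.linearIndependent_cols_iff_isUnit]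
      exact hu
    refine ⟨hM.unit, a, ha, ?_⟩
    have hφ : ∀ i, (linearForm (M i)).IsHomogeneous 1 := fun i => isHomogeneous_linearForm (M i)
    change bind₁ (fun i => linearForm (M i)) F = _
    have h1 : (bind₁ (fun i => linearForm (M i)) F).IsHomogeneous 3 := by
      simpa using hF.aeval _ hφ
    have h3 : (C a * (X 0 ^ 3 + X 1 ^ 3 + X 2 ^ 3) : MvPolynomial (Fin 3) K).IsHomogeneous 3 :=
      (((isHomogeneous_X_pow 0 3).add (isHomogeneous_X_pow 1 3)).add
        (isHomogeneous_X_pow 2 3)).C_mul a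
    refine h1.funext_of_le_card h3 (fun x => ?_) hle
    have e : eval x (bind₁ (fun i => linearForm (M i)) F) =
        eval (x 0 • u 0 + (x 1 • u 1 + x 2 • u 2)) F := by
      rw [← coe_aeval_eq_eval, ← coe_aeval_eq_eval, RingHom.coe_coe, RingHom.coe_coe,
        aeval_bind₁]
      congr 2
      ext i
      simp [M]
      ring
    rw [e, h]
    simp

end Field

end PlaneCurve

theorem lemma2p3 {K : Type*} [Field K] (hK : Nat.card K = 4)
    (F : MvPolynomial (Fin 3) K) (hF : PlaneCurve.IsPlaneCurve F 3)
    (hlin : ¬ PlaneCurve.HasLinearComponent F)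
    (hN : (PlaneCurve.points F).ncard = 9) :
    PlaneCurve.IsAbsolutelyIrreducible F ∧
    (∀ P ∈ PlaneCurve.points F, PlaneCurve.IsNonsingularAt F P) ∧
    ((∀ P ∈ PlaneCurve.points F,
        PlaneCurve.intersectionMultiplicity (PlaneCurve.tangentLine F P) F P = 3) →
      PlaneCurve.IsHermitianCurve 2 F ∧
      PlaneCurve.ProjectivelyEquivalent F
        (MvPolynomial.X 0 ^ 3 + MvPolynomial.X 1 ^ 3 + MvPolynomial.X 2 ^ 3)) := by
  have : Finite K := Nat.finite_of_card_ne_zero (by omega)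
  obtain ⟨hF0, hF⟩ := hF
  have hZ := PlaneCurve.ncard_zeros hF
  rw [hN, hK] at hZ
  have hsm : ∀ P ∈ PlaneCurve.points F, ∃ w, PlaneCurve.polar F P.rep w ≠ 0 := fun P hP =>
    PlaneCurve.exists_polar_ne_zero hK hF hlin hZ P.rep_nonzero hP
  refine ⟨PlaneCurve.irreducible_map hK hF hF0 hlin hZ, fun P hP => ?_, fun hflex => ?_⟩
  · obtain ⟨w, hw⟩ := hsm P hP
    by_contra hns
    simp only [PlaneCurve.IsNonsingularAt, not_exists, not_not] at hns
    exact hw (by simp [PlaneCurve.polar, hns])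
  · obtain ⟨P, hP⟩ := Set.nonempty_of_ncard_ne_zero (s := PlaneCurve.points F) (by omega)
    have hP0 : MvPolynomial.eval P.rep F = 0 := hP
    obtain ⟨w, u, hli, hw, hu⟩ := PlaneCurve.exists_tangent_direction P.rep_nonzero (hsm P hP)
      (by rw [PlaneCurve.polar_self hF, hP0, mul_zero])
    -- This coefficient vanishes exactly when the tangent line meets the cubic to order three at
    -- `P`; otherwise the multiplicity would be at most 2.
    have hwv : PlaneCurve.polar F w P.rep = 0 := by
      by_contra hwv
      have h := PlaneCurve.intersectionMultiplicity_le_two hK hF hli hP0 hw hu hwv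
      rw [hflex P hP] at h
      exact absurd h (by decide)
    have hpair : LinearIndependent K ![P.rep, w] := by
      simpa using PlaneCurve.linearIndependent_pair_of_triple hli (y := 1) (z := 0) (by simp)
    obtain ⟨b, hb, a, ha, hab⟩ :=
      PlaneCurve.exists_fermat_coordinates hK hF hlin hZ hpair hP0 hw hwv
    exact PlaneCurve.hermitian_of_fermat_coordinates hK hF hb ha hab
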